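/- For $a>0$ let $\rho_a(\phi)=2\pi\int_0^\phi\cos\xi\sqrt{a^2\cos^2\xi+\sin^2\xi}\,d\xi$ for $\phi\in[0,\frac\pi2]$, $L_a=\rho_a(\frac\pi2)$, let $\phi_a\colon[0,L_a]\to[0,\frac\pi2]$ be the inverse of $\rho_a$, and $\varphi_a(\rho)=\pi a\sin(2\phi_a(\rho))$. Let $\Omega_a$ be the $2$-disk with polar coordinates $(\rho,\theta)$, $0\le\rho\le L_a$, and metric $d\rho^2+\varphi_a(\rho)^2d\theta^2$ (the orbit space of the ellipsoid $\{(z,w)\in\mathbb C^2:|z|^2/a^2+|w|^2=1\}$ under rotations of $w$, with its quotient metric multiplied by the square of the length of the orbits). Fix functions $\beta_a\colon(-1,1)\to(0,L_a)$, real analytic in $(a,s)\in(0,+\infty)\times(-1,1)$, such that for each $a>0$: $\beta_a'(s)>0$ for all $s$, $\beta_a$ is onto $(0,L_a)$, and $\beta_a(0)=\rho_a(\frac\pi4)$. Let $\gamma_{a,s}(t)=(\rho_{a,s}(t),\theta_{a,s}(t))$ be the maximal geodesic in $\Omega_a$ with $\gamma_{a,s}(0)=(\beta_a(s),0)$ and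 $\dot\gamma_{a,s}(0)=(0,1)$, i.e., the maximal solution of $$\ddot\rho-\varphi_a(\rho)\varphi_a'(\rho)\dot\theta^2=0,\qquad \ddot\theta+2\tfrac{\varphi_a'(\rho)}{\varphi_a(\rho)}\dot\rho\,\dot\theta=0$$ in $0<\rho<L_a$ with these initial conditions. For an integer $k\ge1$ let $\ell_k(a,s)>0$ be the time with $\theta_{a,s}(\ell_k(a,s))=k\pi$, and set $f_k(a,s)=\dot\rho_{a,s}(\ell_k(a,s))$, a function on the strip $(0,+\infty)\times(-1,1)$. For integers $0<j<2k$ with $\gcd(j,k)=1$, let $a^j_k=\frac{j/k}{\sqrt{4-(j/k)^2}}$, and let $\mathcal B_{(j,k)}$ be the connected component containing $(a^j_k,0)$ of the closure, in the strip, of $f_k^{-1}(0)\setminus\{(a,0):a>0\}$. **Proposition.** Let $0<j<2k$ be integers with $\gcd(j,k)=1$. If a sequence $(a_n,s_n)\in\mathcal B_{(j,k)}$ converges in $[0,+\infty]\times[-1,1]$ and $|s_n|\to1$, then either $a_n\to0$ or $a_n\to+\infty$. In particular, the restriction to $\mathcal B_{(j,k)}$ of the projection $\Pi\colon(0,+\infty)\times(-1,1)\to(0,+\infty)$,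 $\Pi(a,s)=a$, is a proper map. -/

import Mathlib

open Set Filter Topology

noncomputable section

namespace EllipsoidTori

/-- Arclength `ρ(φ)`, measured from the center `O` along a radial direction of the disk `Ω_a`, whose
metric is `4π² cos²φ ((a² cos²φ + sin²φ) dφ² + a² sin²φ dθ²)` for `0 ≤ φ ≤ π/2`. -/
def arclen (a φ : ℝ) : ℝ :=
  2 * Real.pi * ∫ ξ in (0 : ℝ)..φ,
    Real.cos ξ * Real.sqrt (a ^ 2 * Real.cos ξ ^ 2 + Real.sin ξ ^ 2)

/-- The radius `L_a` of the disk `Ω_a`. -/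
def radius (a : ℝ) : ℝ := arclen a (Real.pi / 2)

/-- `φ(ρ)`: the inverse of the arclength function `[0, π/2] → [0, L_a]`. -/
def latitude (a : ℝ) : ℝ → ℝ := Function.invFunOn (arclen a) (Icc 0 (Real.pi / 2))

/-- The warping function `φ(ρ) = π a sin (2 φ(ρ))`, so that the metric of `Ω_a` is
`dρ² + warp(ρ)² dθ²`. -/
def warp (a ρ : ℝ) : ℝ := Real.pi * a * Real.sin (2 * latitude a ρ)

/-- The radius `ρ_{a,0}` of the Clifford geodesic, i.e. the point where `φ = π/4`. -/
def cliffordRadius (a : ℝ) : ℝ := arclen a (Real.pi / 4)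

/-- `t ↦ (ρ t, θ t)` satisfies the geodesic equation of `dρ² + warp(ρ)² dθ²` on the
(open) set of times `I`, and stays in the region `0 < ρ < L_a`. -/
def IsGeodesicOn (a : ℝ) (I : Set ℝ) (ρ θ : ℝ → ℝ) : Prop :=
  ∀ t ∈ I, ρ t ∈ Ioo 0 (radius a) ∧
    DifferentiableAt ℝ ρ t ∧ DifferentiableAt ℝ θ t ∧
    HasDerivAt (deriv ρ) (warp a (ρ t) * deriv (warp a) (ρ t) * deriv θ t ^ 2) t ∧
    HasDerivAt (deriv θ)
      (-(2 * (deriv (warp a) (ρ t) / warp a (ρ t)) * deriv ρ t * deriv θ t)) t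

/-- `(ρ, θ)` is a geodesic on the open interval `I ∋ 0`, starting at `(b, 0)` with velocity
`(0, 1)`, hence orthogonally to the radial geodesic `θ = 0`. -/
structure IsOrthogonalGeodesic (a b : ℝ) (I : Set ℝ) (ρ θ : ℝ → ℝ) : Prop where
  isOpen : IsOpen I
  ordConnected : I.OrdConnected
  zero_mem : (0 : ℝ) ∈ I
  geodesic : IsGeodesicOn a I ρ θ
  rho_zero : ρ 0 = b
  theta_zero : θ 0 = 0
  deriv_rho_zero : deriv ρ 0 = 0
  deriv_theta_zero : deriv θ 0 = 1

/-- An orthogonal geodesic whose interval of definition is the largest possible one. -/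
def IsMaximalOrthogonalGeodesic (a b : ℝ) (I : Set ℝ) (ρ θ : ℝ → ℝ) : Prop :=
  IsOrthogonalGeodesic a b I ρ θ ∧
    ∀ (J : Set ℝ) (ρ' θ' : ℝ → ℝ), IsOrthogonalGeodesic a b J ρ' θ' → J ⊆ I

/-- The maximal geodesic of `Ω_a` starting at `(b, 0)` with velocity `(0, 1)`: its interval of
definition and its two coordinate functions. -/
def orthGeodesic (a b : ℝ) : Set ℝ × (ℝ → ℝ) × (ℝ → ℝ) :=
  Classical.epsilon fun γ => IsMaximalOrthogonalGeodesic a b γ.1 γ.2.1 γ.2.2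

/-- The (only) positive time at which the maximal orthogonal geodesic from `(b, 0)` has
`θ = k π`. -/
def hitTime (k : ℕ) (a b : ℝ) : ℝ :=
  sInf {t : ℝ | t ∈ (orthGeodesic a b).1 ∧ 0 < t ∧ (orthGeodesic a b).2.2 t = k * Real.pi}

/-- The strip `(0, +∞) × (-1, 1)`. -/
abbrev Strip : Type := Ioi (0 : ℝ) × Ioo (-1 : ℝ) 1

/-- The choice of parametrizations `β a : (-1, 1) → (0, L_a)` of the radial geodesic `θ = 0`:
real analytic in `(a, s)`, with positive derivative in `s`, going from the center to the boundary,
and passing through the Clifford geodesic at `s = 0`. -/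
structure IsRadialParam (β : ℝ → ℝ → ℝ) : Prop where
  analytic : AnalyticOnNhd ℝ (fun p : ℝ × ℝ => β p.1 p.2) (Ioi 0 ×ˢ Ioo (-1) 1)
  apply_zero : ∀ a, 0 < a → β a 0 = cliffordRadius a
  deriv_pos : ∀ a, 0 < a → ∀ s ∈ Ioo (-1 : ℝ) 1, 0 < deriv (β a) s
  image_eq : ∀ a, 0 < a → β a '' Ioo (-1) 1 = Ioo 0 (radius a)

/-- `f_k(a, s)`, the radial velocity of `γ_{a,s}` at the time `ℓ_k(a, s)`. -/
def closingFn (β : ℝ → ℝ → ℝ) (k : ℕ) (p : Strip) : ℝ :=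
  deriv (orthGeodesic p.1 (β p.1 p.2)).2.1 (hitTime k p.1 (β p.1 p.2))

/-- The trivial branch `{(a, 0) : a > 0}`. -/
def trivialBranch : Set Strip := {p | (p.2 : ℝ) = 0}

/-- The closure, in the strip, of the set of nontrivial zeros of `f_k`. -/
def nontrivialZeros (β : ℝ → ℝ → ℝ) (k : ℕ) : Set Strip :=
  closure ({p | closingFn β k p = 0} \ trivialBranch)

/-- The bifurcation instant `a^j_k = (j/k) / √(4 - (j/k)²)`. -/
def bifInstant (j k : ℕ) : ℝ := ((j : ℝ) / k) / Real.sqrt (4 - ((j : ℝ) / k) ^ 2)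

theorem bifInstant_pos {j k : ℕ} (hj : 0 < j) (hjk : j < 2 * k) : 0 < bifInstant j k := by
  have hk : (0 : ℝ) < k := by
    have : 0 < k := by omega
    exact_mod_cast this
  have hj' : (0 : ℝ) < j := by exact_mod_cast hj
  have hq : (0 : ℝ) < (j : ℝ) / k := by positivity
  have hq2 : (j : ℝ) / k < 2 := by
    rw [div_lt_iff₀ hk]
    exact_mod_cast hjk
  exact div_pos hq (Real.sqrt_pos.mpr (by nlinarith))

/-- The point `(a^j_k, 0)` of the strip. -/
def bifPoint {j k : ℕ} (hj : 0 < j) (hjk : j < 2 * k) : Strip :=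
  (⟨bifInstant j k, bifInstant_pos hj hjk⟩, ⟨0, by norm_num⟩)

/-- The bifurcation branch `𝓑_(j,k)`: the connected component of the closure of the nontrivial
zeros of `f_k` that contains `(a^j_k, 0)`. -/
def branch (β : ℝ → ℝ → ℝ) {j k : ℕ} (hj : 0 < j) (hjk : j < 2 * k) : Set Strip :=
  connectedComponentIn (nontrivialZeros β k) (bifPoint hj hjk)

end EllipsoidTori

end

/-! Follow a geodesic orthogonal to θ = 0 at latitude φ₀, and put c = cos 2φ₀, σ = sin 2φ₀.
Clairaut's relation and conservation of energy give cos 2φ = c cos τ, where τ is an increasing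
reparametrization of time (`exists_phase`). If c ≠ 0, a later time with vanishing radial velocity
has τ = mπ with m a positive integer. Moreover dθ/dτ = σR / (4a sin²φ cos φ) with R = √(a² cos²φ +
sin²φ), and a cos φ < R ≤ a cos φ + sin φ. The main term σ/(4 sin²φ) = σ/(2(1 - c cos τ)) is a
Poisson kernel, whose integral over [0, mπ] is mπ/2 whatever c is. Hence θ = kπ gives m < 2k, so m ≤
2k - 1, while the remainder contributes at most mπ√σ/(2a). Together these force (a/2k)² ≤ σ
(`le_sin_two_latitude`).

So the nontrivial zeros of f_k stay away from s = ±1, locally uniformly in a > 0, and so does their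
closure (`nontrivialZeros_locally_bounded`). Both claims follow by compactness; of the branch one
uses only that it is closed and lies in this closure. Completeness (`exists_isOrthogonalGeodesic`)
is what gives the chosen geodesic and its hitting time their meaning. -/

namespace EllipsoidTori

/-! ### Arclength, latitude and the warping function -/

/-- The derivative of `arclen a`. -/
noncomputable def arclenDeriv (a φ : ℝ) : ℝ :=
  2 * Real.pi * (Real.cos φ * Real.sqrt (a ^ 2 * Real.cos φ ^ 2 + Real.sin φ ^ 2))

theorem hasStrictDerivAt_arclen (a φ : ℝ) : HasStrictDerivAt (arclen a) (arclenDeriv a φ) φ := by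
  have hc : Continuous fun ξ : ℝ =>
      Real.cos ξ * Real.sqrt (a ^ 2 * Real.cos ξ ^ 2 + Real.sin ξ ^ 2) := by fun_prop
  exact (hc.integral_hasStrictDerivAt 0 φ).const_mul (2 * Real.pi)

theorem hasDerivAt_arclen (a φ : ℝ) : HasDerivAt (arclen a) (arclenDeriv a φ) φ :=
  (hasStrictDerivAt_arclen a φ).hasDerivAt

theorem continuous_arclen (a : ℝ) : Continuous (arclen a) :=
  continuous_iff_continuousAt.2 fun φ => (hasDerivAt_arclen a φ).continuousAt

theorem continuous_arclen_left (φ : ℝ) : Continuous fun a => arclen a φ := by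
  unfold arclen
  refine continuous_const.mul ?_
  apply intervalIntegral.continuous_parametric_intervalIntegral_of_continuous'
  fun_prop

@[simp]
theorem arclen_zero (a : ℝ) : arclen a 0 = 0 := by simp [arclen]

theorem sq_add_sq_pos {a : ℝ} (ha : 0 < a) (φ : ℝ) :
    0 < a ^ 2 * Real.cos φ ^ 2 + Real.sin φ ^ 2 := by
  by_contra! h
  have h1 : Real.sin φ ^ 2 = 0 := le_antisymm (by nlinarith [sq_nonneg (a * Real.cos φ)])
    (sq_nonneg _)
  have h2 := Real.sin_sq_add_cos_sq φ
  have h3 : 0 < a ^ 2 := by positivity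
  nlinarith

theorem arclenDeriv_pos {a : ℝ} (ha : 0 < a) {φ : ℝ} (hφ : 0 < Real.cos φ) :
    0 < arclenDeriv a φ := by
  have := Real.sqrt_pos.2 (sq_add_sq_pos ha φ)
  have := Real.pi_pos
  unfold arclenDeriv
  positivity

theorem strictMonoOn_arclen {a : ℝ} (ha : 0 < a) :
    StrictMonoOn (arclen a) (Icc 0 (Real.pi / 2)) := by
  refine strictMonoOn_of_deriv_pos (convex_Icc _ _) (continuous_arclen a).continuousOn ?_
  intro x hx
  rw [interior_Icc] at hx
  rw [(hasDerivAt_arclen a x).deriv]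
  exact arclenDeriv_pos ha (Real.cos_pos_of_mem_Ioo ⟨by linarith [hx.1, Real.pi_pos], hx.2⟩)

theorem latitude_arclen {a : ℝ} (ha : 0 < a) {φ : ℝ} (hφ : φ ∈ Icc 0 (Real.pi / 2)) :
    latitude a (arclen a φ) = φ :=
  (strictMonoOn_arclen ha).injOn.leftInvOn_invFunOn hφ

theorem arclen_mem {a : ℝ} (ha : 0 < a) {φ : ℝ} (hφ : φ ∈ Ioo 0 (Real.pi / 2)) :
    arclen a φ ∈ Ioo 0 (radius a) := by
  have hpi := Real.pi_pos
  constructor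
  · simpa using strictMonoOn_arclen ha ⟨le_rfl, by positivity⟩ (Ioo_subset_Icc_self hφ) hφ.1
  · exact strictMonoOn_arclen ha (Ioo_subset_Icc_self hφ) ⟨by positivity, le_rfl⟩ hφ.2

theorem exists_arclen_eq {a r : ℝ} (hr : r ∈ Ioo 0 (radius a)) :
    ∃ φ ∈ Ioo 0 (Real.pi / 2), arclen a φ = r := by
  have h := intermediate_value_Ioo (by positivity : (0 : ℝ) ≤ Real.pi / 2)
    (continuous_arclen a).continuousOn
  rw [arclen_zero] at h
  exact h hr

theorem latitude_mem {a r : ℝ} (ha : 0 < a) (hr : r ∈ Ioo 0 (radius a)) :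
    latitude a r ∈ Ioo 0 (Real.pi / 2) := by
  obtain ⟨φ, hφ, rfl⟩ := exists_arclen_eq hr
  rwa [latitude_arclen ha (Ioo_subset_Icc_self hφ)]

theorem arclen_latitude {a r : ℝ} (ha : 0 < a) (hr : r ∈ Ioo 0 (radius a)) :
    arclen a (latitude a r) = r := by
  obtain ⟨φ, hφ, rfl⟩ := exists_arclen_eq hr
  rw [latitude_arclen ha (Ioo_subset_Icc_self hφ)]

theorem cos_latitude_pos {a r : ℝ} (ha : 0 < a) (hr : r ∈ Ioo 0 (radius a)) :
    0 < Real.cos (latitude a r) := by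
  have h := latitude_mem ha hr
  exact Real.cos_pos_of_mem_Ioo ⟨by linarith [h.1, Real.pi_pos], h.2⟩

theorem sin_latitude_pos {a r : ℝ} (ha : 0 < a) (hr : r ∈ Ioo 0 (radius a)) :
    0 < Real.sin (latitude a r) := by
  have h := latitude_mem ha hr
  exact Real.sin_pos_of_mem_Ioo ⟨h.1, by linarith [h.2, Real.pi_pos]⟩

theorem sin_two_latitude_pos {a r : ℝ} (ha : 0 < a) (hr : r ∈ Ioo 0 (radius a)) :
    0 < Real.sin (2 * latitude a r) := by
  rw [Real.sin_two_mul]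
  have := cos_latitude_pos ha hr
  have := sin_latitude_pos ha hr
  positivity

theorem warp_pos {a r : ℝ} (ha : 0 < a) (hr : r ∈ Ioo 0 (radius a)) : 0 < warp a r := by
  have := sin_two_latitude_pos ha hr
  have := Real.pi_pos
  unfold warp
  positivity

theorem hasDerivAt_latitude {a r : ℝ} (ha : 0 < a) (hr : r ∈ Ioo 0 (radius a)) :
    HasDerivAt (latitude a) (arclenDeriv a (latitude a r))⁻¹ r := by
  have h := latitude_mem ha hr
  have h1 : ∀ᶠ x in 𝓝 (latitude a r), latitude a (arclen a x) = x := by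
    filter_upwards [Ioo_mem_nhds h.1 h.2] with x hx
    exact latitude_arclen ha (Ioo_subset_Icc_self hx)
  have h2 := (hasStrictDerivAt_arclen a (latitude a r)).to_local_left_inverse
    (arclenDeriv_pos ha (cos_latitude_pos ha hr)).ne' h1
  rw [arclen_latitude ha hr] at h2
  exact h2.hasDerivAt

theorem hasDerivAt_warp {a r : ℝ} (ha : 0 < a) (hr : r ∈ Ioo 0 (radius a)) :
    HasDerivAt (warp a) (Real.pi * a * (Real.cos (2 * latitude a r) *
      (2 * (arclenDeriv a (latitude a r))⁻¹))) r :=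
  (((hasDerivAt_latitude ha hr).const_mul 2).sin).const_mul (Real.pi * a)

/-! ### First integrals and the phase -/

/-- Along an orthogonal geodesic, `cos (2 latitude)` is a harmonic oscillation in a suitable
phase `τ`. -/
theorem IsOrthogonalGeodesic.exists_phase {a b : ℝ} {ρ θ : ℝ → ℝ} (ha : 0 < a)
    (hb : b ∈ Ioo 0 (radius a)) (h : IsOrthogonalGeodesic a b univ ρ θ) :
    ∃ τ : ℝ → ℝ, τ 0 = 0 ∧ ∀ t,
      HasDerivAt τ (2 * warp a b * (arclenDeriv a (latitude a (ρ t)))⁻¹) t ∧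
      Real.cos (2 * latitude a (ρ t)) = Real.cos (2 * latitude a b) * Real.cos (τ t) ∧
      deriv ρ t * Real.sin (2 * latitude a (ρ t)) =
        warp a b * (Real.cos (2 * latitude a b) * Real.sin (τ t)) ∧
      HasDerivAt θ (warp a b ^ 2 / warp a (ρ t) ^ 2) t := by
  have hm : ∀ t, ρ t ∈ Ioo 0 (radius a) := fun t => (h.geodesic t trivial).1
  have dρ : ∀ t, HasDerivAt ρ (deriv ρ t) t := fun t => (h.geodesic t trivial).2.1.hasDerivAt
  have dθ : ∀ t, HasDerivAt θ (deriv θ t) t := fun t => (h.geodesic t trivial).2.2.1.hasDerivAt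
  have ddρ := fun t => (h.geodesic t trivial).2.2.2.1
  have ddθ := fun t => (h.geodesic t trivial).2.2.2.2
  have hW : ∀ t, 0 < warp a (ρ t) := fun t => warp_pos ha (hm t)
  have w0 : 0 < warp a b := warp_pos ha hb
  have dW : ∀ t, HasDerivAt (fun t => warp a (ρ t)) (deriv (warp a) (ρ t) * deriv ρ t) t :=
    fun t => (hasDerivAt_warp ha (hm t)).differentiableAt.hasDerivAt.comp t (dρ t)
  have const : ∀ f : ℝ → ℝ, (∀ t, HasDerivAt f 0 t) → ∀ t, f t = f 0 := fun f hf t =>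
    is_const_of_deriv_eq_zero (fun t => (hf t).differentiableAt) (fun t => (hf t).deriv) t 0
  have clairaut : ∀ t, warp a (ρ t) ^ 2 * deriv θ t = warp a b ^ 2 := by
    intro t
    have := const (fun t => warp a (ρ t) ^ 2 * deriv θ t) (fun t => by
      refine (((dW t).pow 2).mul (ddθ t)).congr_deriv ?_
      have := (hW t).ne'
      simp only [Pi.pow_apply]
      field_simp
      ring) t
    simpa [h.rho_zero, h.deriv_theta_zero] using this
  have energy : ∀ t, deriv ρ t ^ 2 + warp a (ρ t) ^ 2 * deriv θ t ^ 2 = warp a b ^ 2 := by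
    intro t
    have := const (fun t => deriv ρ t ^ 2 + warp a (ρ t) ^ 2 * deriv θ t ^ 2) (fun t => by
      refine (((ddρ t).pow 2).add (((dW t).pow 2).mul ((ddθ t).pow 2))).congr_deriv ?_
      have := (hW t).ne'
      simp only [Pi.pow_apply]
      field_simp
      ring) t
    simpa [h.rho_zero, h.deriv_theta_zero, h.deriv_rho_zero] using this
  have dlat : ∀ t, HasDerivAt (fun t => latitude a (ρ t))
      ((arclenDeriv a (latitude a (ρ t)))⁻¹ * deriv ρ t) t :=
    fun t => (hasDerivAt_latitude ha (hm t)).comp t (dρ t)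
  have clat : Continuous fun t => latitude a (ρ t) :=
    continuous_iff_continuousAt.2 fun t => (dlat t).continuousAt
  have hD : ∀ t, 0 < arclenDeriv a (latitude a (ρ t)) := fun t =>
    arclenDeriv_pos ha (cos_latitude_pos ha (hm t))
  -- With this speed the pair u = cos 2φ, v = ρ' w / (π a w₀) rotates: u' = -ωv and v' = ωu.
  -- Rotating back through τ = ∫ω gives the constants of `c1` and `c2`.
  set ω : ℝ → ℝ := fun t => 2 * warp a b * (arclenDeriv a (latitude a (ρ t)))⁻¹ with hω
  have cω : Continuous ω := by
    refine continuous_const.mul (Continuous.inv₀ ?_ fun t => (hD t).ne')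
    unfold arclenDeriv
    fun_prop
  have dτ : ∀ t, HasDerivAt (fun t => ∫ x in (0 : ℝ)..t, ω x) (ω t) t := fun t =>
    cω.integral_hasStrictDerivAt 0 t |>.hasDerivAt
  refine ⟨fun t => ∫ x in (0 : ℝ)..t, ω x, by simp, ?_⟩
  set τ : ℝ → ℝ := fun t => ∫ x in (0 : ℝ)..t, ω x with hτ
  have τ0 : τ 0 = 0 := by simp [hτ]
  have du : ∀ t, HasDerivAt (fun t => Real.cos (2 * latitude a (ρ t)))
      (-(ω t * (deriv ρ t * warp a (ρ t) / (Real.pi * a * warp a b)))) t := by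
    intro t
    refine ((dlat t).const_mul 2).cos.congr_deriv ?_
    have := w0.ne'
    have := (hD t).ne'
    have := Real.pi_pos.ne'
    have := ha.ne'
    have hs : Real.sin (2 * latitude a (ρ t)) = warp a (ρ t) / (Real.pi * a) := by
      unfold warp; field_simp
    simp only [hω, hs]
    field_simp
  have dv : ∀ t, HasDerivAt (fun t => deriv ρ t * warp a (ρ t) / (Real.pi * a * warp a b))
      (ω t * Real.cos (2 * latitude a (ρ t))) t := by
    intro t
    refine (((ddρ t).mul (dW t)).div_const (Real.pi * a * warp a b)).congr_deriv ?_
    have := w0.ne'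
    have := Real.pi_pos.ne'
    have := ha.ne'
    have e : warp a (ρ t) * deriv (warp a) (ρ t) * deriv θ t ^ 2 * warp a (ρ t) +
        deriv ρ t * (deriv (warp a) (ρ t) * deriv ρ t) =
        deriv (warp a) (ρ t) * warp a b ^ 2 := by rw [← energy t]; ring
    rw [e, (hasDerivAt_warp ha (hm t)).deriv]
    simp only [hω]
    field_simp
  have c1 : ∀ t, Real.cos (2 * latitude a (ρ t)) * Real.cos (τ t) +
      deriv ρ t * warp a (ρ t) / (Real.pi * a * warp a b) * Real.sin (τ t) =
      Real.cos (2 * latitude a b) := by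
    intro t
    have := const _ (fun t => (((du t).mul (dτ t).cos).add ((dv t).mul (dτ t).sin)).congr_deriv
      (by simp only [hτ]; ring)) t
    simpa [h.rho_zero, h.deriv_rho_zero, τ0] using this
  have c2 : ∀ t, deriv ρ t * warp a (ρ t) / (Real.pi * a * warp a b) * Real.cos (τ t) -
      Real.cos (2 * latitude a (ρ t)) * Real.sin (τ t) = 0 := by
    intro t
    have := const _ (fun t => (((dv t).mul (dτ t).cos).sub ((du t).mul (dτ t).sin)).congr_deriv
      (by simp only [hτ]; ring)) t
    simpa [h.rho_zero, h.deriv_rho_zero, τ0] using this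
  intro t
  have hcs := Real.sin_sq_add_cos_sq (τ t)
  refine ⟨dτ t, ?_, ?_, ?_⟩
  · linear_combination Real.cos (τ t) * c1 t - Real.sin (τ t) * c2 t -
      Real.cos (2 * latitude a (ρ t)) * hcs
  · have hs : Real.sin (2 * latitude a (ρ t)) = warp a (ρ t) / (Real.pi * a) := by
      have := Real.pi_pos.ne'
      have := ha.ne'
      unfold warp; field_simp
    have e : deriv ρ t * warp a (ρ t) / (Real.pi * a * warp a b) =
        Real.cos (2 * latitude a b) * Real.sin (τ t) := by
      linear_combination Real.sin (τ t) * c1 t + Real.cos (τ t) * c2 t -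
        deriv ρ t * warp a (ρ t) / (Real.pi * a * warp a b) * hcs
    rw [hs, ← e]
    have := w0.ne'
    field_simp
  · refine (dθ t).congr_deriv ?_
    rw [← clairaut t]
    have := (hW t).ne'
    field_simp

/-! ### Poisson kernels and the two-sided angle estimate -/

/-- A primitive of `σ / (2 (1 - c cos x))` on the whole line, when `σ² + c² = 1`, `σ > 0`. -/
noncomputable def poissonPrimitive (σ c x : ℝ) : ℝ :=
  x / 2 + Real.arctan (c * Real.sin x / (1 + σ - c * Real.cos x))

theorem abs_mul_cos_lt_one {σ c : ℝ} (hσ : 0 < σ) (h : σ ^ 2 + c ^ 2 = 1) (x : ℝ) :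
    |c * Real.cos x| < 1 := by
  rw [← sq_lt_one_iff_abs_lt_one]
  nlinarith [Real.cos_sq_le_one x, mul_nonneg (sq_nonneg c) (sub_nonneg.2 (Real.cos_sq_le_one x)),
    pow_pos hσ 2]

/-- The usual primitive through tan (x/2) jumps at odd multiples of π. Splitting off x/2 leaves an
arctangent whose denominator 1 + σ - c cos x never vanishes. -/
theorem hasDerivAt_poissonPrimitive {σ c : ℝ} (hσ : 0 < σ) (h : σ ^ 2 + c ^ 2 = 1) (x : ℝ) :
    HasDerivAt (poissonPrimitive σ c) (σ / (2 * (1 - c * Real.cos x))) x := by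
  have h1 := (abs_lt.1 (abs_mul_cos_lt_one hσ h x)).2
  have hD : 0 < 1 + σ - c * Real.cos x := by linarith
  have hE : 0 < 1 - c * Real.cos x := by linarith
  have hd := ((hasDerivAt_id x).div_const 2).add
    (((Real.hasDerivAt_sin x).const_mul c).fun_div
      (((Real.hasDerivAt_cos x).const_mul c).const_sub (1 + σ)) hD.ne').arctan
  refine hd.congr_deriv ?_
  have hsum : 1 + (c * Real.sin x / (1 + σ - c * Real.cos x)) ^ 2 =
      2 * (1 + σ) * (1 - c * Real.cos x) / (1 + σ - c * Real.cos x) ^ 2 := by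
    field_simp
    linear_combination c ^ 2 * Real.sin_sq_add_cos_sq x + h
  have hnum : c * Real.cos x * (1 + σ - c * Real.cos x) - c * Real.sin x * -(c * -Real.sin x) =
      (1 + σ) * (c * Real.cos x - (1 - σ)) := by
    linear_combination (-c ^ 2) * Real.sin_sq_add_cos_sq x - h
  rw [hsum, hnum]
  have : 0 < 1 + σ := by linarith
  field_simp
  ring

theorem poissonPrimitive_int_mul_pi (σ c : ℝ) (m : ℤ) :
    poissonPrimitive σ c (m * Real.pi) = m * Real.pi / 2 := by
  simp [poissonPrimitive, Real.sin_int_mul_pi]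

/-- Here q = √σ, s = sin φ, p = cos φ. The error q²/(4asp) coming from R ≤ ap + s equals (q/4a)·2x
with x = q/(2sp), and 2x ≤ 1 + x². Now q²x² is replaced by Poisson kernels, and the prefactor q is
the gain that makes the error small as σ → 0. -/
theorem angle_rate_upper {a s p q R : ℝ} (ha : 0 < a) (hs : 0 < s) (hp : 0 < p) (hq : 0 < q)
    (hR : 0 < R) (hRle : R ≤ a * p + s) :
    q ^ 4 / (4 * s ^ 2 * p ^ 2) ≤ a * q ^ 2 / (p * R) *
      (q ^ 2 / (4 * s ^ 2) + q / (4 * a) * (1 + q ^ 2 / (4 * s ^ 2 * p ^ 2))) := by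
  have h1 : q ^ 2 * R / (4 * s ^ 2 * p) ≤ q ^ 2 * (a * p + s) / (4 * s ^ 2 * p) := by gcongr
  have h2 : q ^ 2 * (a * p + s) / (4 * s ^ 2 * p) ≤
      a * (q ^ 2 / (4 * s ^ 2) + q / (4 * a) * (1 + q ^ 2 / (4 * s ^ 2 * p ^ 2))) := by
    rw [← sub_nonneg]
    have : a * (q ^ 2 / (4 * s ^ 2) + q / (4 * a) * (1 + q ^ 2 / (4 * s ^ 2 * p ^ 2))) -
      q ^ 2 * (a * p + s) / (4 * s ^ 2 * p) = q / 4 * (1 - q / (2 * s * p)) ^ 2 := by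
      field_simp
      ring
    rw [this]
    positivity
  have h3 := mul_le_mul_of_nonneg_left (h1.trans h2) (by positivity : 0 ≤ q ^ 2 / (p * R))
  refine (le_of_eq ?_).trans (h3.trans (le_of_eq ?_)) <;> field_simp

/-- A nontrivial geodesic which is orthogonal to a radial geodesic at the angles `0` and `k π`
stays away from the center and from the boundary of the disk. -/
theorem IsOrthogonalGeodesic.le_sin_two_latitude {a b t : ℝ} {ρ θ : ℝ → ℝ} {k : ℕ} (ha : 0 < a)
    (hb : b ∈ Ioo 0 (radius a)) (h : IsOrthogonalGeodesic a b univ ρ θ)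
    (hc : Real.cos (2 * latitude a b) ≠ 0) (ht : 0 < t) (hθ : θ t = k * Real.pi)
    (hρ : deriv ρ t = 0) : (a / (2 * k)) ^ 2 ≤ Real.sin (2 * latitude a b) := by
  have hpi := Real.pi_pos
  obtain ⟨τ, τ0, hτ⟩ := h.exists_phase ha hb
  have hm : ∀ t, ρ t ∈ Ioo 0 (radius a) := fun t => (h.geodesic t trivial).1
  have hσ : 0 < Real.sin (2 * latitude a b) := sin_two_latitude_pos ha hb
  have w0 : 0 < warp a b := warp_pos ha hb
  have hw0 : warp a b = Real.pi * a * Real.sin (2 * latitude a b) := rfl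
  have hσc := Real.sin_sq_add_cos_sq (2 * latitude a b)
  set σ := Real.sin (2 * latitude a b)
  set c := Real.cos (2 * latitude a b)
  have dτ := fun t => (hτ t).1
  have τmono : StrictMono τ := strictMono_of_deriv_pos fun t => by
    rw [(dτ t).deriv]
    have := arclenDeriv_pos ha (cos_latitude_pos ha (hm t))
    positivity
  have τpos : 0 < τ t := τ0 ▸ τmono ht
  obtain ⟨m, hmt⟩ : ∃ m : ℤ, (m : ℝ) * Real.pi = τ t := by
    refine Real.sin_eq_zero_iff.1 ?_
    have := (hτ t).2.2.1
    rw [hρ, zero_mul, eq_comm, mul_eq_zero, mul_eq_zero] at this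
    exact (this.resolve_left w0.ne').resolve_left hc
  have mpos : (0 : ℝ) < m := by
    rw [← hmt] at τpos
    exact pos_of_mul_pos_left τpos hpi.le
  have hσc' : σ ^ 2 + (-c) ^ 2 = 1 := by rw [neg_sq]; exact hσc
  have dA : ∀ t, HasDerivAt (fun t => poissonPrimitive σ c (τ t)) _ t := fun t =>
    (hasDerivAt_poissonPrimitive hσ hσc (τ t)).comp t (dτ t)
  -- The parameter -c is needed because 1 + c cos τ = 2 cos²φ.
  have dA' : ∀ t, HasDerivAt (fun t => poissonPrimitive σ (-c) (τ t)) _ t := fun t =>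
    (hasDerivAt_poissonPrimitive hσ hσc' (τ t)).comp t (dτ t)
  have A0 : ∀ c, poissonPrimitive σ c 0 = 0 := fun c => by simp [poissonPrimitive]
  have hR := fun t => Real.sqrt_pos.2 (sq_add_sq_pos ha (latitude a (ρ t)))
  have hp := fun t => cos_latitude_pos ha (hm t)
  have hs := fun t => sin_latitude_pos ha (hm t)
  have hy : ∀ t, c * Real.cos (τ t) = 1 - 2 * Real.sin (latitude a (ρ t)) ^ 2 := fun t => by
    rw [← (hτ t).2.1, Real.cos_two_mul]
    linear_combination 2 * Real.sin_sq_add_cos_sq (latitude a (ρ t))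
  have hy' : ∀ t, c * Real.cos (τ t) = 2 * Real.cos (latitude a (ρ t)) ^ 2 - 1 := fun t => by
    rw [← (hτ t).2.1, Real.cos_two_mul]
  have hω : ∀ t, 2 * warp a b * (arclenDeriv a (latitude a (ρ t)))⁻¹ =
      a * σ / (Real.cos (latitude a (ρ t)) *
        Real.sqrt (a ^ 2 * Real.cos (latitude a (ρ t)) ^ 2 + Real.sin (latitude a (ρ t)) ^ 2)) := by
    intro t
    have := (hR t).ne'
    have := (hp t).ne'
    rw [hw0]
    unfold arclenDeriv
    field_simp
  have hθ' : ∀ t, warp a b ^ 2 / warp a (ρ t) ^ 2 =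
      σ ^ 2 / (4 * Real.sin (latitude a (ρ t)) ^ 2 * Real.cos (latitude a (ρ t)) ^ 2) := by
    intro t
    have := (hs t).ne'
    have := (hp t).ne'
    rw [hw0]
    unfold warp
    rw [Real.sin_two_mul]
    field_simp
    ring
  have lower : (m : ℝ) * Real.pi / 2 < k * Real.pi := by
    have mono : StrictMono fun t => θ t - poissonPrimitive σ c (τ t) := by
      refine strictMono_of_deriv_pos fun t => ?_
      rw [((hτ t).2.2.2.fun_sub (dA t)).deriv, sub_pos, hω, hθ', hy]
      have hs := hs t
      have hp := hp t
      have hR := hR t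
      have hlt : a * Real.cos (latitude a (ρ t)) < Real.sqrt (a ^ 2 *
          Real.cos (latitude a (ρ t)) ^ 2 + Real.sin (latitude a (ρ t)) ^ 2) := by
        apply Real.lt_sqrt_of_sq_lt
        rw [mul_pow]
        have := pow_pos hs 2
        linarith
      generalize Real.sqrt (a ^ 2 *
          Real.cos (latitude a (ρ t)) ^ 2 + Real.sin (latitude a (ρ t)) ^ 2) = R at *
      generalize Real.sin (latitude a (ρ t)) = s at *
      generalize Real.cos (latitude a (ρ t)) = p at *
      have e1 : σ / (2 * (1 - (1 - 2 * s ^ 2))) * (a * σ / (p * R)) =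
          σ ^ 2 / (4 * s ^ 2 * p ^ 2) * (a * p / R) := by
        have : (2 * (1 - (1 - 2 * s ^ 2))) = 4 * s ^ 2 := by ring
        rw [this]
        field_simp
      rw [e1]
      exact mul_lt_of_lt_one_right (by positivity) ((div_lt_one hR).2 hlt)
    have := mono ht
    simp only [h.theta_zero, τ0, A0, ← hmt, poissonPrimitive_int_mul_pi, hθ] at this
    linarith
  have upper : (k : ℝ) * Real.pi ≤ m * Real.pi / 2 +
      Real.sqrt σ / (4 * a) * (m * Real.pi + (m * Real.pi / 2 + m * Real.pi / 2)) := by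
    have mono : Monotone fun t => (poissonPrimitive σ c (τ t) + Real.sqrt σ / (4 * a) *
        (τ t + (poissonPrimitive σ c (τ t) + poissonPrimitive σ (-c) (τ t)))) - θ t := by
      have hd := fun t => ((dA t).fun_add (((dτ t).fun_add ((dA t).fun_add (dA' t))).const_mul
        (Real.sqrt σ / (4 * a)))).fun_sub (hτ t).2.2.2
      refine monotone_of_deriv_nonneg (fun t => (hd t).differentiableAt) fun t => ?_
      rw [(hd t).deriv, sub_nonneg, neg_mul, hθ', hy', hω, ← hy', hy]
      -- The third occurrence belongs to the kernel of parameter -c, which is to be written with cos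
      -- φ instead of sin φ.
      nth_rewrite 3 [← hy]
      rw [hy']
      have hs := hs t
      have hp := hp t
      have hR := hR t
      have hle : Real.sqrt (a ^ 2 * Real.cos (latitude a (ρ t)) ^ 2 +
          Real.sin (latitude a (ρ t)) ^ 2) ≤
          a * Real.cos (latitude a (ρ t)) + Real.sin (latitude a (ρ t)) := by
        apply Real.sqrt_le_iff.2 ⟨by positivity, ?_⟩
        have : 0 < a * Real.cos (latitude a (ρ t)) * Real.sin (latitude a (ρ t)) := by positivity
        linarith
      have hq := Real.sqrt_pos.2 hσ
      have hsp := Real.sin_sq_add_cos_sq (latitude a (ρ t))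
      have hσq := Real.sq_sqrt hσ.le
      generalize Real.sqrt (a ^ 2 *
          Real.cos (latitude a (ρ t)) ^ 2 + Real.sin (latitude a (ρ t)) ^ 2) = R at *
      generalize Real.sin (latitude a (ρ t)) = s at *
      generalize Real.cos (latitude a (ρ t)) = p at *
      generalize Real.sqrt σ = q at *
      have key := angle_rate_upper ha hs hp hq hR hle
      have e1 : (2 * (1 - (1 - 2 * s ^ 2))) = 4 * s ^ 2 := by ring
      have e2 : (2 * (1 - -(2 * p ^ 2 - 1))) = 4 * p ^ 2 := by ring
      -- Since s² + p² = 1, the quadratic term splits into the two kernels of parameters c and -c.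
      have e3 : q ^ 2 / (4 * s ^ 2 * p ^ 2) = q ^ 2 / (4 * s ^ 2) + q ^ 2 / (4 * p ^ 2) := by
        field_simp
        linarith
      rw [e3] at key
      rw [e1, e2, ← hσq]
      convert key using 1 <;> ring
    have := mono ht.le
    simp only [h.theta_zero, τ0, A0, ← hmt, poissonPrimitive_int_mul_pi, hθ] at this
    linarith
  have hmk : (m : ℝ) < 2 * k := by nlinarith
  -- Integrality gives a gap of 1, which the error term m√σ/a must fill.
  have hmk' : (m : ℝ) + 1 ≤ 2 * k := by exact_mod_cast hmk
  have hk : (0 : ℝ) < 2 * k := by linarith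
  have hq := Real.sqrt_nonneg σ
  have h1 : (2 * k : ℝ) ≤ m + m * Real.sqrt σ / a := by
    have e : (m : ℝ) * Real.pi / 2 +
      Real.sqrt σ / (4 * a) * (m * Real.pi + (m * Real.pi / 2 + m * Real.pi / 2)) =
      (m + m * Real.sqrt σ / a) / 2 * Real.pi := by field_simp; ring
    rw [e] at upper
    linarith [le_of_mul_le_mul_right upper hpi]
  have h2 : a ≤ m * Real.sqrt σ := by
    rw [← one_le_div ha]
    linarith
  have h3 : a / (2 * k) ≤ Real.sqrt σ := by
    rw [div_le_iff₀ hk]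
    nlinarith
  calc (a / (2 * k)) ^ 2 ≤ Real.sqrt σ ^ 2 := by gcongr
    _ = σ := Real.sq_sqrt hσ.le

/-! ### Existence and completeness of orthogonal geodesics -/

/-- Every real function with derivative bounded below by a positive constant has a global
differentiable inverse. -/
theorem exists_hasDerivAt_inverse {T T' : ℝ → ℝ} {m : ℝ} (hm : 0 < m)
    (hT : ∀ x, HasDerivAt T (T' x) x) (hT' : ∀ x, m ≤ T' x) :
    ∃ τ : ℝ → ℝ, (∀ x, τ (T x) = x) ∧ (∀ t, T (τ t) = t) ∧
      ∀ t, HasDerivAt τ (T' (τ t))⁻¹ t := by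
  have hmono : StrictMono T := strictMono_of_deriv_pos fun x => by
    rw [(hT x).deriv]; exact hm.trans_le (hT' x)
  have hlow : Monotone fun x => T x - m * x := by
    have hd := fun x => (hT x).fun_sub ((hasDerivAt_id x).const_mul m)
    refine monotone_of_deriv_nonneg (fun x => (hd x).differentiableAt) fun x => ?_
    have := (hd x).deriv
    simp only [id] at this
    rw [this]
    linarith [hT' x]
  have htop : Tendsto T atTop atTop := by
    refine tendsto_atTop_mono' atTop ?_
      (tendsto_atTop_add_const_right atTop (T 0) (tendsto_id.const_mul_atTop hm))
    filter_upwards [eventually_ge_atTop 0] with x hx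
    have := hlow hx
    simp only [id] at this ⊢
    linarith
  have hbot : Tendsto T atBot atBot := by
    refine tendsto_atBot_mono' atBot ?_
      (tendsto_atBot_add_const_right atBot (T 0) (tendsto_id.const_mul_atBot hm))
    filter_upwards [eventually_le_atBot 0] with x hx
    have := hlow hx
    simp only [id] at this ⊢
    linarith
  have hcont : Continuous T := continuous_iff_continuousAt.2 fun x => (hT x).continuousAt
  let e := hmono.orderIsoOfSurjective T (hcont.surjective htop hbot)
  refine ⟨e.symm, fun x => e.symm_apply_apply x, e.apply_symm_apply, fun t => ?_⟩
  exact HasDerivAt.of_local_left_inverse e.symm.continuous.continuousAt (hT _)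
    (hm.trans_le (hT' _)).ne' (Eventually.of_forall fun y => e.apply_symm_apply y)

/-- The orthogonal geodesics of the disk are complete. -/
theorem exists_isOrthogonalGeodesic {a b : ℝ} (ha : 0 < a) (hb : b ∈ Ioo 0 (radius a)) :
    ∃ ρ θ : ℝ → ℝ, IsOrthogonalGeodesic a b univ ρ θ := by
  have hpi := Real.pi_pos
  have hφ := latitude_mem ha hb
  have hbφ := arclen_latitude ha hb
  have hσ := sin_two_latitude_pos ha hb
  have w0 := warp_pos ha hb
  have hw0 : warp a b = Real.pi * a * Real.sin (2 * latitude a b) := rfl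
  have hσc := Real.sin_sq_add_cos_sq (2 * latitude a b)
  have hψ0 : Real.arccos (Real.cos (2 * latitude a b)) = 2 * latitude a b :=
    Real.arccos_cos (by linarith [hφ.1]) (by linarith [hφ.2])
  set σ := Real.sin (2 * latitude a b)
  set c := Real.cos (2 * latitude a b)
  have hc : |c| < 1 := by
    rw [← sq_lt_one_iff_abs_lt_one]; nlinarith
  have hy : ∀ x, -1 < c * Real.cos x ∧ c * Real.cos x < 1 := fun x => by
    rw [← abs_lt, abs_mul]
    nlinarith [abs_nonneg c, Real.abs_cos_le_one x]
  -- The latitude as a function of the phase x, solved from cos 2φ = c cos x.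
  let ψ : ℝ → ℝ := fun x => Real.arccos (c * Real.cos x) / 2
  have hcosψ : ∀ x, Real.cos (2 * ψ x) = c * Real.cos x := fun x => by
    simp only [ψ, mul_div_cancel₀ _ (two_ne_zero' ℝ)]
    exact Real.cos_arccos (hy x).1.le (hy x).2.le
  have hsinψ : ∀ x, Real.sin (2 * ψ x) = Real.sqrt (1 - (c * Real.cos x) ^ 2) := fun x => by
    simp only [ψ, mul_div_cancel₀ _ (two_ne_zero' ℝ)]
    exact Real.sin_arccos _
  have hSpos : ∀ x, 0 < Real.sin (2 * ψ x) := fun x => by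
    rw [hsinψ, Real.sqrt_pos, sub_pos, sq_lt_one_iff_abs_lt_one, abs_lt]
    exact hy x
  have hψmem : ∀ x, ψ x ∈ Ioo 0 (Real.pi / 2) := fun x => by
    have h1 : 0 ≤ ψ x := div_nonneg (Real.arccos_nonneg _) two_pos.le
    have h2 : ψ x ≤ Real.pi / 2 := div_le_div_of_nonneg_right (Real.arccos_le_pi _) two_pos.le
    refine ⟨h1.lt_of_ne fun h => ?_, h2.lt_of_ne fun h => ?_⟩
    · have := hSpos x
      simp [← h] at this
    · have := hSpos x
      simp [h, mul_div_cancel₀ _ (two_ne_zero' ℝ)] at this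
  have hcospos : ∀ x, 0 < Real.cos (ψ x) := fun x =>
    Real.cos_pos_of_mem_Ioo ⟨by linarith [(hψmem x).1], (hψmem x).2⟩
  have dψ : ∀ x, HasDerivAt ψ (c * Real.sin x / (2 * Real.sin (2 * ψ x))) x := fun x => by
    have h1 := (Real.hasDerivAt_arccos (hy x).1.ne' (hy x).2.ne).comp x
      ((Real.hasDerivAt_cos x).const_mul c)
    refine (h1.div_const 2).congr_deriv ?_
    rw [hsinψ]
    ring
  have cψ : Continuous ψ := continuous_iff_continuousAt.2 fun x => (dψ x).continuousAt
  have hD := fun x => arclenDeriv_pos ha (hcospos x)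
  -- The derivative of time with respect to phase. As |c| < 1 keeps cos φ away from 0, it is bounded
  -- below, so time can be inverted on the whole line.
  let T' : ℝ → ℝ := fun x => arclenDeriv a (ψ x) / (2 * warp a b)
  have cT' : Continuous T' := by
    refine Continuous.div_const ?_ _
    unfold arclenDeriv
    fun_prop
  have hT'low : ∀ x, Real.pi * a * (1 - |c|) / (2 * warp a b) ≤ T' x := fun x => by
    have h1 : a * Real.cos (ψ x) ≤
        Real.sqrt (a ^ 2 * Real.cos (ψ x) ^ 2 + Real.sin (ψ x) ^ 2) := by
      apply Real.le_sqrt_of_sq_le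
      nlinarith [sq_nonneg (Real.sin (ψ x))]
    have h2 : 1 - |c| ≤ 2 * Real.cos (ψ x) ^ 2 := by
      have := Real.cos_sq (ψ x)
      rw [hcosψ] at this
      have h3 : -(c * Real.cos x) ≤ |c| := by
        refine (neg_le_abs _).trans ?_
        rw [abs_mul]
        exact mul_le_of_le_one_right (abs_nonneg _) (Real.abs_cos_le_one x)
      linarith
    refine div_le_div_of_nonneg_right ?_ (by positivity)
    calc Real.pi * a * (1 - |c|) ≤ Real.pi * a * (2 * Real.cos (ψ x) ^ 2) := by gcongr
      _ = 2 * Real.pi * (Real.cos (ψ x) * (a * Real.cos (ψ x))) := by ring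
      _ ≤ arclenDeriv a (ψ x) := by
        unfold arclenDeriv
        have := hcospos x
        gcongr
  obtain ⟨τ, hτT, -, dτ⟩ := exists_hasDerivAt_inverse
    (T := fun x => ∫ u in (0 : ℝ)..x, T' u)
    (by have := sub_pos.2 hc; positivity) (fun x => (cT'.integral_hasStrictDerivAt 0 x).hasDerivAt)
    hT'low
  have τ0 : τ 0 = 0 := by simpa using hτT 0
  have cτ : Continuous τ := continuous_iff_continuousAt.2 fun x => (dτ x).continuousAt
  let ρ : ℝ → ℝ := fun t => arclen a (ψ (τ t))
  -- The angular velocity dictated by Clairaut's relation.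
  let ϑ : ℝ → ℝ := fun t => (σ / Real.sin (2 * ψ (τ t))) ^ 2
  let θ : ℝ → ℝ := fun t => ∫ u in (0 : ℝ)..t, ϑ u
  have cϑ : Continuous ϑ :=
    (continuous_const.div (by fun_prop) fun t => (hSpos (τ t)).ne').pow 2
  have dθ : ∀ t, HasDerivAt θ (ϑ t) t := fun t =>
    (cϑ.integral_hasStrictDerivAt 0 t).hasDerivAt
  have dψτ := fun t => (dψ (τ t)).comp t (dτ t)
  have dρ : ∀ t, HasDerivAt ρ (warp a b * (c * Real.sin (τ t)) / Real.sin (2 * ψ (τ t))) t := by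
    intro t
    refine ((hasDerivAt_arclen a (ψ (τ t))).comp t (dψτ t)).congr_deriv ?_
    have := (hD (τ t)).ne'
    have := (hSpos (τ t)).ne'
    simp only [T']
    field_simp
  have eρ : deriv ρ = fun t => warp a b * (c * Real.sin (τ t)) / Real.sin (2 * ψ (τ t)) :=
    funext fun t => (dρ t).deriv
  have eθ : deriv θ = ϑ := funext fun t => (dθ t).deriv
  have hmem : ∀ t, ρ t ∈ Ioo 0 (radius a) := fun t => arclen_mem ha (hψmem _)
  have hlat : ∀ t, latitude a (ρ t) = ψ (τ t) := fun t =>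
    latitude_arclen ha (Ioo_subset_Icc_self (hψmem _))
  have hW : ∀ t, warp a (ρ t) = Real.pi * a * Real.sin (2 * ψ (τ t)) := fun t => by
    unfold warp; rw [hlat]
  have hW' : ∀ t, deriv (warp a) (ρ t) = Real.pi * a * (c * Real.cos (τ t) *
      (2 * (arclenDeriv a (ψ (τ t)))⁻¹)) := fun t => by
    rw [(hasDerivAt_warp ha (hmem t)).deriv, hlat, hcosψ]
  have hSS : ∀ x, Real.sin (2 * ψ x) ^ 2 - (c * Real.sin x) ^ 2 = σ ^ 2 := fun x => by
    have := Real.sin_sq_add_cos_sq (2 * ψ x)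
    rw [hcosψ] at this
    linear_combination this - hσc - c ^ 2 * Real.sin_sq_add_cos_sq x
  have hψ00 : ψ 0 = latitude a b := by simp [ψ, hψ0]
  refine ⟨ρ, θ, isOpen_univ, ordConnected_univ, mem_univ _, fun t _ => ⟨hmem t,
    (dρ t).differentiableAt, (dθ t).differentiableAt, ?_, ?_⟩, ?_, ?_, ?_, ?_⟩
  · rw [eρ, eθ, hW, hW']
    have hd := ((((dτ t).sin).const_mul c).const_mul (warp a b)).fun_div
      (((dψτ t).const_mul 2).sin) (hSpos (τ t)).ne'
    refine hd.congr_deriv ?_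
    have := (hD (τ t)).ne'
    have hS := (hSpos (τ t)).ne'
    have h1 := hSS (τ t)
    have h2 := hcosψ (τ t)
    simp only [T', ϑ, Function.comp_def, h2]
    rw [hw0]
    generalize Real.sin (2 * ψ (τ t)) = S at *
    field_simp
    linear_combination (c * Real.cos (τ t)) * h1
  · rw [eρ, eθ, hW, hW']
    have hd := ((hasDerivAt_const t σ).fun_div (((dψτ t).const_mul 2).sin)
      (hSpos (τ t)).ne').fun_pow 2
    refine hd.congr_deriv ?_
    have := (hD (τ t)).ne'
    have hS := (hSpos (τ t)).ne'
    have h2 := hcosψ (τ t)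
    simp only [T', ϑ, Function.comp_def, h2, Nat.add_one_sub_one, pow_one, Nat.cast_ofNat]
    generalize Real.sin (2 * ψ (τ t)) = S at *
    field_simp
    ring
  · simp only [ρ, τ0, hψ00, hbφ]
  · simp [θ]
  · simp [eρ, τ0]
  · rw [eθ]
    simp only [ϑ, τ0, hψ00]
    rw [div_self hσ.ne', one_pow]

/-! ### The chosen geodesic and its hitting time -/

/-- A complete geodesic exists, so every maximal one is defined on the whole line. No uniqueness of
the coordinate functions is needed. -/
theorem orthGeodesic_spec {a b : ℝ} (ha : 0 < a) (hb : b ∈ Ioo 0 (radius a)) :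
    (orthGeodesic a b).1 = univ ∧
      IsOrthogonalGeodesic a b univ (orthGeodesic a b).2.1 (orthGeodesic a b).2.2 := by
  obtain ⟨ρ, θ, h⟩ := exists_isOrthogonalGeodesic ha hb
  have hex : ∃ γ : Set ℝ × (ℝ → ℝ) × (ℝ → ℝ),
      IsMaximalOrthogonalGeodesic a b γ.1 γ.2.1 γ.2.2 :=
    ⟨(univ, ρ, θ), h, fun _ _ _ _ => subset_univ _⟩
  have hs : IsMaximalOrthogonalGeodesic a b (orthGeodesic a b).1 (orthGeodesic a b).2.1
    (orthGeodesic a b).2.2 := Classical.epsilon_spec hex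
  have hu : (orthGeodesic a b).1 = univ := univ_subset_iff.1 (hs.2 univ ρ θ h)
  exact ⟨hu, hu ▸ hs.1⟩

/-- The angle is an increasing bijection of the line along an orthogonal geodesic. -/
theorem IsOrthogonalGeodesic.strictMono_and_surjective {a b : ℝ} {ρ θ : ℝ → ℝ} (ha : 0 < a)
    (hb : b ∈ Ioo 0 (radius a)) (h : IsOrthogonalGeodesic a b univ ρ θ) :
    StrictMono θ ∧ Function.Surjective θ := by
  obtain ⟨τ, -, hτ⟩ := h.exists_phase ha hb
  have hW := fun t => warp_pos ha (h.geodesic t trivial).1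
  have w0 := warp_pos ha hb
  have hpi := Real.pi_pos
  have hlow : ∀ t, warp a b ^ 2 / (Real.pi * a) ^ 2 ≤ warp a b ^ 2 / warp a (ρ t) ^ 2 := by
    intro t
    have := hW t
    have hle : warp a (ρ t) ≤ Real.pi * a :=
      mul_le_of_le_one_right (by positivity) (Real.sin_le_one _)
    gcongr
  have hmono : StrictMono θ := strictMono_of_deriv_pos fun t => by
    rw [(hτ t).2.2.2.deriv]
    have := hW t
    positivity
  refine ⟨hmono, ?_⟩
  obtain ⟨η, -, hη, -⟩ := exists_hasDerivAt_inverse (by positivity) (fun t => (hτ t).2.2.2) hlow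
  exact fun t => ⟨η t, hη t⟩

theorem hitTime_spec {k : ℕ} {a b : ℝ} (hk : 0 < k) (ha : 0 < a) (hb : b ∈ Ioo 0 (radius a)) :
    0 < hitTime k a b ∧ (orthGeodesic a b).2.2 (hitTime k a b) = k * Real.pi := by
  obtain ⟨hu, h⟩ := orthGeodesic_spec ha hb
  obtain ⟨hmono, hsurj⟩ := h.strictMono_and_surjective ha hb
  obtain ⟨t, ht⟩ := hsurj (k * Real.pi)
  have ht0 : 0 < t := by
    rw [← hmono.lt_iff_lt, h.theta_zero, ht]
    have := Real.pi_pos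
    positivity
  have hset : {t : ℝ | t ∈ (orthGeodesic a b).1 ∧ 0 < t ∧
      (orthGeodesic a b).2.2 t = k * Real.pi} = {t} := by
    ext s
    simp only [hu, mem_univ, true_and, mem_ofPred_eq, mem_singleton_iff]
    refine ⟨fun hs => hmono.injective (hs.2.trans ht.symm), ?_⟩
    rintro rfl
    exact ⟨ht0, ht⟩
  have : hitTime k a b = t := by rw [hitTime, hset, csInf_singleton]
  rw [this]
  exact ⟨ht0, ht⟩

/-! ### From latitudes to the parameter s -/

namespace IsRadialParam

variable {β : ℝ → ℝ → ℝ}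

theorem mem_Ioo (hβ : IsRadialParam β) {a s : ℝ} (ha : 0 < a) (hs : s ∈ Ioo (-1 : ℝ) 1) :
    β a s ∈ Ioo 0 (radius a) :=
  hβ.image_eq a ha ▸ mem_image_of_mem _ hs

theorem strictMonoOn (hβ : IsRadialParam β) {a : ℝ} (ha : 0 < a) :
    StrictMonoOn (β a) (Ioo (-1) 1) := by
  refine strictMonoOn_of_deriv_pos (convex_Ioo _ _) (fun s hs => ?_) fun s hs => ?_
  · exact (differentiableAt_of_deriv_ne_zero
      (hβ.deriv_pos a ha s hs).ne').continuousAt.continuousWithinAt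
  · rw [interior_Ioo] at hs
    exact hβ.deriv_pos a ha s hs

theorem continuousAt_left (hβ : IsRadialParam β) {a s : ℝ} (ha : 0 < a)
    (hs : s ∈ Ioo (-1 : ℝ) 1) : ContinuousAt (fun a => β a s) a := by
  have h : ContinuousAt (fun p : ℝ × ℝ => β p.1 p.2) (a, s) :=
    (hβ.analytic (a, s) ⟨ha, hs⟩).continuousAt
  exact h.comp (f := fun a => (a, s)) (by fun_prop)

/-- In the range of latitudes, cos 2φ vanishes only at π/4, which β reaches only at s = 0. -/
theorem cos_two_latitude_ne_zero (hβ : IsRadialParam β) {a s : ℝ} (ha : 0 < a)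
    (hs : s ∈ Ioo (-1 : ℝ) 1) (hs0 : s ≠ 0) : Real.cos (2 * latitude a (β a s)) ≠ 0 := by
  intro h
  have hb := hβ.mem_Ioo ha hs
  have hφ := latitude_mem ha hb
  have h2 : 2 * latitude a (β a s) = Real.pi / 2 :=
    Real.injOn_cos ⟨by linarith [hφ.1], by linarith [hφ.2]⟩
      ⟨by linarith [Real.pi_pos], by linarith [Real.pi_pos]⟩ (by rw [h, Real.cos_pi_div_two])
  have h3 : latitude a (β a s) = Real.pi / 4 := by linarith
  have h4 : β a s = β a 0 := by
    rw [hβ.apply_zero a ha, cliffordRadius, ← h3, arclen_latitude ha hb]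
  exact hs0 ((hβ.strictMonoOn ha).injOn hs (by norm_num) h4)

/-- A nontrivial zero of `f_k` is not too close to the ends of the radial geodesic. -/
theorem le_sin_two_latitude (hβ : IsRadialParam β) {k : ℕ} (hk : 0 < k) {p : Strip}
    (hp : closingFn β k p = 0) (hp0 : p ∉ trivialBranch) :
    ((p.1 : ℝ) / (2 * k)) ^ 2 ≤ Real.sin (2 * latitude p.1 (β p.1 p.2)) := by
  have ha : (0 : ℝ) < p.1 := p.1.2
  have hb := hβ.mem_Ioo ha p.2.2
  obtain ⟨ht, hθ⟩ := hitTime_spec hk ha hb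
  exact (orthGeodesic_spec ha hb).2.le_sin_two_latitude ha hb
    (hβ.cos_two_latitude_ne_zero ha p.2.2 hp0) ht hθ hp

/-- Locally in `a`, points of the radial geodesic with latitude away from `0` and `π / 2` have
parameter away from `±1`. -/
theorem eventually_mem_Icc (hβ : IsRadialParam β) {a₀ δ : ℝ} (ha₀ : 0 < a₀)
    (hδ : δ ∈ Ioo 0 (Real.pi / 2)) :
    ∃ s₁ ∈ Ioo (-1 : ℝ) 1, ∃ s₂ ∈ Ioo (-1 : ℝ) 1, ∀ᶠ a in 𝓝 a₀, ∀ s ∈ Ioo (-1 : ℝ) 1,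
      latitude a (β a s) ∈ Icc δ (Real.pi / 2 - δ) → s ∈ Icc s₁ s₂ := by
  have key : ∀ φ ∈ Ioo 0 (Real.pi / 2), ∃ s ∈ Ioo (-1 : ℝ) 1, β a₀ s = arclen a₀ φ := by
    intro φ hφ
    have := arclen_mem ha₀ hφ
    rw [← hβ.image_eq a₀ ha₀] at this
    exact this
  -- Halving δ makes the inequalities at a₀ strict, so that they persist for nearby a.
  obtain ⟨s₁, hs₁, e₁⟩ := key (δ / 2) ⟨by linarith [hδ.1], by linarith [hδ.1, hδ.2]⟩
  obtain ⟨s₂, hs₂, e₂⟩ := key (Real.pi / 2 - δ / 2) ⟨by linarith [hδ.1, hδ.2], by linarith [hδ.1]⟩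
  refine ⟨s₁, hs₁, s₂, hs₂, ?_⟩
  have l₁ : β a₀ s₁ < arclen a₀ δ := by
    rw [e₁]
    exact strictMonoOn_arclen ha₀ ⟨by linarith [hδ.1], by linarith [hδ.1, hδ.2]⟩
      (Ioo_subset_Icc_self hδ) (by linarith [hδ.1])
  have l₂ : arclen a₀ (Real.pi / 2 - δ) < β a₀ s₂ := by
    rw [e₂]
    exact strictMonoOn_arclen ha₀ ⟨by linarith [hδ.2], by linarith [hδ.1]⟩
      ⟨by linarith [hδ.1, hδ.2], by linarith [hδ.1]⟩ (by linarith [hδ.1])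
  filter_upwards [lt_mem_nhds ha₀,
    (hβ.continuousAt_left ha₀ hs₁).eventually_lt (continuous_arclen_left _).continuousAt l₁,
    (continuous_arclen_left _).continuousAt.eventually_lt (hβ.continuousAt_left ha₀ hs₂) l₂]
    with a ha h₁ h₂ s hs hlat
  have hb := hβ.mem_Ioo ha hs
  have hmono := (strictMonoOn_arclen ha).monotoneOn
  have hl := Ioo_subset_Icc_self (latitude_mem ha hb)
  have b₁ := hmono (Ioo_subset_Icc_self hδ) hl hlat.1
  have b₂ := hmono hl ⟨by linarith [hδ.1, hδ.2], by linarith [hδ.1]⟩ hlat.2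
  rw [arclen_latitude ha hb] at b₁ b₂
  exact ⟨((hβ.strictMonoOn ha).lt_iff_lt hs₁ hs).1 (h₁.trans_le b₁) |>.le,
    ((hβ.strictMonoOn ha).lt_iff_lt hs hs₂).1 (b₂.trans_lt h₂) |>.le⟩

/-- The closure of the nontrivial zeros of `f_k` stays, locally in `a`, away from the sides
`s = ±1` of the strip. -/
theorem nontrivialZeros_locally_bounded (hβ : IsRadialParam β) {k : ℕ} (hk : 0 < k) {a₀ : ℝ}
    (ha₀ : 0 < a₀) :
    ∃ U : Set ℝ, IsOpen U ∧ a₀ ∈ U ∧ ∃ s₁ ∈ Ioo (-1 : ℝ) 1, ∃ s₂ ∈ Ioo (-1 : ℝ) 1,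
      ∀ p ∈ nontrivialZeros β k, (p.1 : ℝ) ∈ U → (p.2 : ℝ) ∈ Icc s₁ s₂ := by
  have hk' : (0 : ℝ) < k := by exact_mod_cast hk
  have hpi := Real.pi_pos
  -- A lower bound for sin 2φ valid for all a > a₀/2. As sin x ≤ x, it keeps φ at distance ε/2 from
  -- 0 and π/2.
  set ε : ℝ := (a₀ / 2 / (2 * k)) ^ 2 with hε
  have hε0 : 0 < ε := by positivity
  set δ : ℝ := min (ε / 2) (Real.pi / 4) with hδ
  have hδ0 : 0 < δ := by positivity
  have hδ' : δ ∈ Ioo 0 (Real.pi / 2) := ⟨hδ0, by linarith [min_le_right (ε / 2) (Real.pi / 4)]⟩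
  obtain ⟨s₁, hs₁, s₂, hs₂, hev⟩ := hβ.eventually_mem_Icc ha₀ hδ'
  obtain ⟨U, hU, hUo, haU⟩ := eventually_nhds_iff.1 (hev.and (lt_mem_nhds (half_lt_self ha₀)))
  refine ⟨U, hUo, haU, s₁, hs₁, s₂, hs₂, fun p hp hpU => ?_⟩
  have hV : IsOpen {p : Strip | (p.1 : ℝ) ∈ U} := hUo.preimage (by fun_prop)
  have hC : IsClosed {p : Strip | (p.2 : ℝ) ∈ Icc s₁ s₂} := isClosed_Icc.preimage (by fun_prop)
  -- As U is open and the bound on s is closed, it suffices to check genuine nontrivial zeros over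
  -- U.
  refine closure_minimal ?_ hC (hV.inter_closure ⟨hpU, hp⟩)
  rintro q ⟨hqU, hq, hq0⟩
  have ha : (0 : ℝ) < q.1 := q.1.2
  have hb := hβ.mem_Ioo ha q.2.2
  have hφ := latitude_mem ha hb
  have h1 := hβ.le_sin_two_latitude hk hq hq0
  have h2 : ε ≤ ((q.1 : ℝ) / (2 * k)) ^ 2 := by
    have := (hU _ hqU).2.le
    rw [hε]
    gcongr
  refine (hU _ hqU).1 _ q.2.2 ⟨?_, ?_⟩
  · have := Real.sin_le (by linarith [hφ.1] : 0 ≤ 2 * latitude q.1 (β q.1 q.2))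
    linarith [min_le_left (ε / 2) (Real.pi / 4)]
  · have := Real.sin_le (by linarith [hφ.2] : 0 ≤ Real.pi - 2 * latitude q.1 (β q.1 q.2))
    rw [Real.sin_pi_sub] at this
    linarith [min_le_left (ε / 2) (Real.pi / 4)]

end IsRadialParam

/-! ### Closedness and properness of the branch -/

variable {β : ℝ → ℝ → ℝ} {j k : ℕ} {hj : 0 < j} {hjk : j < 2 * k}

theorem branch_subset : branch β hj hjk ⊆ nontrivialZeros β k := connectedComponentIn_subset _ _

theorem isClosed_branch : IsClosed (branch β hj hjk) := by
  by_cases hx : bifPoint hj hjk ∈ nontrivialZeros β k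
  · refine isClosed_of_closure_subset ?_
    exact isPreconnected_connectedComponentIn.closure.subset_connectedComponentIn
      (subset_closure (mem_connectedComponentIn hx))
      (closure_minimal branch_subset isClosed_closure)
  -- The component is empty by convention here, so the bifurcation point need not be shown to lie in
  -- the set.
  · rw [branch, connectedComponentIn_eq_empty hx]
    exact isClosed_empty

theorem isProperMap_domRestrict_branch (hβ : IsRadialParam β) :
    IsProperMap ((branch β hj hjk).domRestrict (Prod.fst : Strip → Ioi (0 : ℝ))) := by
  have hk : 0 < k := by omega
  rw [isProperMap_iff_ultrafilter]
  refine ⟨continuous_fst.comp continuous_subtype_val, fun 𝒰 a h𝒰 => ?_⟩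
  obtain ⟨U, hUo, haU, s₁, hs₁, s₂, hs₂, hU⟩ := hβ.nontrivialZeros_locally_bounded hk a.2
  have hUev : ∀ᶠ p : branch β hj hjk in 𝒰, ((p : Strip).1 : ℝ) ∈ U :=
    (continuous_subtype_val.tendsto a |>.comp h𝒰).eventually (hUo.mem_nhds haU)
  let σ : branch β hj hjk → ℝ := fun p => (p : Strip).2
  -- Over U the s-coordinates lie in a compact subinterval of (-1, 1), so the ultrafilter converges
  -- inside the strip.
  obtain ⟨s, hs, hs𝒰⟩ := (isCompact_Icc (a := s₁) (b := s₂)).ultrafilter_le_nhds (𝒰.map σ)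
    (le_principal_iff.2 (hUev.mono fun p hp => hU p (branch_subset p.2) hp))
  have hs' : s ∈ Ioo (-1 : ℝ) 1 := ⟨hs₁.1.trans_le hs.1, hs.2.trans_lt hs₂.2⟩
  let x : Strip := (a, ⟨s, hs'⟩)
  have hlim : Tendsto (fun p : branch β hj hjk => (p : Strip)) 𝒰 (𝓝 x) :=
    h𝒰.prodMk_nhds (tendsto_subtype_rng.2 hs𝒰)
  have hx : x ∈ branch β hj hjk :=
    isClosed_branch.mem_of_tendsto hlim (Eventually.of_forall fun p => p.2)
  exact ⟨⟨x, hx⟩, rfl, tendsto_subtype_rng.2 hlim⟩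

end EllipsoidTori

theorem mainTheorem5 (β : ℝ → ℝ → ℝ) (hβ : EllipsoidTori.IsRadialParam β)
    (j k : ℕ) (hj : 0 < j) (hjk : j < 2 * k) (hgcd : Nat.gcd j k = 1) :
    (∀ x : ℕ → EllipsoidTori.Strip,
      (∀ n, x n ∈ EllipsoidTori.branch β hj hjk) →
      (∃ p : EReal × ℝ,
        Tendsto (fun n => ((((x n).1 : ℝ) : EReal), ((x n).2 : ℝ))) atTop (𝓝 p)) →
      Tendsto (fun n => |((x n).2 : ℝ)|) atTop (𝓝 1) →
      Tendsto (fun n => ((x n).1 : ℝ)) atTop (𝓝[>] 0) ∨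
        Tendsto (fun n => ((x n).1 : ℝ)) atTop atTop) ∧
    IsProperMap ((EllipsoidTori.branch β hj hjk).domRestrict
      (Prod.fst : EllipsoidTori.Strip → Ioi (0 : ℝ))) := by
  refine ⟨?_, EllipsoidTori.isProperMap_domRestrict_branch hβ⟩
  rintro x hx ⟨⟨p, s⟩, hp⟩ hone
  have hpa : Tendsto (fun n => (((x n).1 : ℝ) : EReal)) atTop (𝓝 p) :=
    (continuous_fst.tendsto (p, s)).comp hp
  have hps : Tendsto (fun n => ((x n).2 : ℝ)) atTop (𝓝 s) :=
    (continuous_snd.tendsto (p, s)).comp hp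
  have hpos : ∀ n, (0 : ℝ) < (x n).1 := fun n => (x n).1.2
  have hp0 : 0 ≤ p := ge_of_tendsto' hpa fun n => by exact_mod_cast (hpos n).le
  induction p with
  | bot => simp at hp0
  | top => exact Or.inr (EReal.tendsto_coe_nhds_top_iff.1 hpa)
  | coe a =>
    have ha : Tendsto (fun n => ((x n).1 : ℝ)) atTop (𝓝 a) := EReal.tendsto_coe.1 hpa
    rcases (EReal.coe_nonneg.1 hp0).eq_or_lt with rfl | ha0
    · exact Or.inl (tendsto_nhdsWithin_iff.2 ⟨ha, Eventually.of_forall hpos⟩)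
    -- A finite positive limit of a_n would confine the limit of s_n to a compact part of (-1, 1).
    · exfalso
      obtain ⟨U, hUo, haU, s₁, hs₁, s₂, hs₂, hU⟩ :=
        hβ.nontrivialZeros_locally_bounded (k := k) (by omega) ha0
      have hmem : s ∈ Icc s₁ s₂ := isClosed_Icc.mem_of_tendsto hps
        ((ha.eventually (hUo.mem_nhds haU)).mono fun n hn =>
          hU _ (EllipsoidTori.branch_subset (hx n)) hn)
      have habs : |s| = 1 := tendsto_nhds_unique hps.abs hone
      have : |s| < 1 := abs_lt.2 ⟨hs₁.1.trans_le hmem.1, hmem.2.trans_lt hs₂.2⟩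
      exact this.ne habs
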